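/- Let $F$ be a field and let $I=\{i_1<\dots<i_d\}$, $J=\{j_1<\dots<j_d\}$ be $d$-element subsets of $[n]=\{1,\dots,n\}$. For a $d\times n$ matrix $X$ let $[X]$ be its row span; let $GL_n$ act on row vectors by $g\cdot v=vg^{T}$, let $B,B^-\subset GL_n$ be the upper and lower triangular matrices, and let $e_I$ be the $d\times n$ matrix whose $a$-th row is the $i_a$-th standard basis vector. Let $$R_{I,J}=B^-\cdot[e_I]\,\cap\,B\cdot[e_J]\subset \mathrm{Gr}(d,n)$$ be the open Richardson variety over $F$. For $w\in S_d$ let $R_{I,J}^{w}\subset R_{I,J}$ be the Deodhar-type stratum, that is, the preimage of the double coset $\mathbf B w\mathbf B\subset GL_d$ ($\mathbf B$ the upper triangular matrices in $GL_d$, $w$ acting by $e_b\mapsto e_{w(b)}$) under the base change map $R_{I,J}\to GL_d$, $[X]\mapsto (X_{[d]\times I})^{-1}X_{[d]\times J}$. The same definitions apply with $[n]$ replaced by any finite totally ordered set. Suppose $i_k=j_{k'}=:c\in I\cap J$, and put $I'=I\setminus\{c\}$, $J'=J\setminus\{c\}$, considered as $(d-1)$-element subsets of $[n]\setminus\{c\}$,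 so that $R_{I',J'}\subset\mathrm{Gr}(d-1,[n]\setminus\{c\})$. **Theorem.** If $I\le J$ (that is, $i_a\le j_a$ for all $a$), then $k'\le k$. There is a morphism $\rho:R_{I,J}\to R_{I',J'}$ which is a (Zariski locally trivial) vector bundle of rank $k-k'$; in particular $\rho$ is surjective. (If $I\not\le J$, both sides are empty and the rank carries no information.) Moreover, for every $w\in S_d$ with $w(k')=k$, let $w'\in S_{d-1}$ be the restriction of $w$ to a bijection $[d]\setminus\{k'\}\to[d]\setminus\{k\}$, both sides being renumbered increasingly by $[d-1]$. Then $\rho^{-1}(R_{I',J'}^{w'})=R_{I,J}^{w}$; in particular $\rho$ restricts to a map $R_{I,J}^{w}\to R_{I',J'}^{w'}$. -/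

import Mathlib

open CategoryTheory

universe u

set_option linter.unusedSectionVars false

namespace Richardson

/-! ### Row spans and extension of scalars -/

section Subspaces

variable {A B C : Type u} [CommRing A] [CommRing B] [CommRing C] {ι : Type} {d : ℕ}

/-- The subspace `[X]` of `A^{1 × ι}` spanned by the rows of `X`. -/
def rowSpan (X : Matrix (Fin d) ι A) : Submodule A (ι → A) :=
  Submodule.span A (Set.range X.row)

/-- Extension of scalars of a submodule of `A^{1 × ι}` along `φ : A → B`: the `B`-span of its image.
For a direct summand `W` this is the image of `B ⊗ W` in `B^{1 × ι}`. -/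
def extendScalars (φ : A →+* B) (W : Submodule A (ι → A)) : Submodule B (ι → B) :=
  Submodule.span B ((fun v => φ ∘ v) '' (W : Set (ι → A)))

theorem extendScalars_span (φ : A →+* B) (S : Set (ι → A)) :
    extendScalars φ (Submodule.span A S) = Submodule.span B ((fun v => φ ∘ v) '' S) := by
  apply le_antisymm
  · refine Submodule.span_le.2 ?_
    rintro _ ⟨v, hv, rfl⟩
    induction hv using Submodule.span_induction with
    | mem x hx => exact Submodule.subset_span ⟨x, hx, rfl⟩
    | zero =>
      have : (φ ∘ (0 : ι → A)) = 0 := by ext; simp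
      simp [this]
    | add x y _ _ hx hy =>
      have : (φ ∘ (x + y)) = φ ∘ x + φ ∘ y := by ext; simp
      simpa [this] using add_mem hx hy
    | smul a x _ hx =>
      have : (φ ∘ (a • x)) = φ a • (φ ∘ x) := by ext; simp
      simpa [this] using Submodule.smul_mem _ (φ a) hx
  · exact Submodule.span_mono (Set.image_mono Submodule.subset_span)

theorem extendScalars_id (W : Submodule A (ι → A)) : extendScalars (RingHom.id A) W = W := by
  have : (fun v : ι → A => (RingHom.id A) ∘ v) = id := rfl
  rw [extendScalars, this, Set.image_id, Submodule.span_eq]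

theorem extendScalars_comp (ψ : B →+* C) (φ : A →+* B) (W : Submodule A (ι → A)) :
    extendScalars (ψ.comp φ) W = extendScalars ψ (extendScalars φ W) := by
  conv_rhs => rw [extendScalars.eq_def φ, extendScalars_span, Set.image_image]
  rfl

theorem extendScalars_rowSpan (φ : A →+* B) (X : Matrix (Fin d) ι A) :
    extendScalars φ (rowSpan X) = rowSpan (X.map φ) := by
  rw [rowSpan, extendScalars_span, ← Set.range_comp]
  rfl

end Subspaces

/-! ### Bruhat cells and double cosets on points -/

section Points

variable {A B : Type u} [CommRing A] [CommRing B]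
variable {ι : Type} [Fintype ι] [LinearOrder ι] {d : ℕ}

/-- For `I = {i₁ < ⋯ < i_d}`, given as an increasing map `i`, the matrix `e_I` whose `a`-th row is
the standard basis vector with index `i a`. -/
def coordMatrix (A : Type u) [CommRing A] (i : Fin d ↪o ι) : Matrix (Fin d) ι A :=
  Matrix.of fun a l => if l = i a then 1 else 0

/-- The action `W ↦ g · W` of matrices on subspaces of `A^{1 × ι}` induced by `v ↦ v gᵀ`. -/
def act (g : Matrix ι ι A) (W : Submodule A (ι → A)) : Submodule A (ι → A) :=
  W.map g.mulVecLin

/-- `A`-points of the positive Bruhat cell `Z_I⁺ = B · [e_I]`, for `B ⊂ GL_ι` the group of upper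
triangular matrices. -/
def posCellPoints (A : Type u) [CommRing A] (i : Fin d ↪o ι) : Set (Submodule A (ι → A)) :=
  {W | ∃ g : GL ι A, g.val.IsUpperTriangular ∧ W = act g.val (rowSpan (coordMatrix A i))}

/-- `A`-points of the negative Bruhat cell `Z_I⁻ = B⁻ · [e_I]`, for `B⁻ ⊂ GL_ι` the group of lower
triangular matrices. -/
def negCellPoints (A : Type u) [CommRing A] (i : Fin d ↪o ι) : Set (Submodule A (ι → A)) :=
  {W | ∃ g : GL ι A, g.val.IsLowerTriangular ∧ W = act g.val (rowSpan (coordMatrix A i))}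

/-- The permutation matrix of `w`, which maps the basis vector `e_b` to `e_{w b}`. -/
def permMat (A : Type u) [CommRing A] (w : Equiv.Perm (Fin d)) : Matrix (Fin d) (Fin d) A :=
  Matrix.of fun a b => if a = w b then 1 else 0

/-- `A`-points of the Bruhat double coset `B w B` in `GL_d`, where `B` is the group of
upper triangular matrices. -/
def bruhatPoints (A : Type u) [CommRing A] (w : Equiv.Perm (Fin d)) :
    Set (Matrix (Fin d) (Fin d) A) :=
  {M | ∃ b c : GL (Fin d) A, b.val.IsUpperTriangular ∧ c.val.IsUpperTriangular ∧
    M = b.val * permMat A w * c.val}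

/-- The base change matrix `(X_{[d] × I})⁻¹ X_{[d] × J}`. -/
noncomputable def baseChangeMatrix (i j : Fin d ↪o ι) (X : Matrix (Fin d) ι A) :
    Matrix (Fin d) (Fin d) A :=
  (X.submatrix id i)⁻¹ * X.submatrix id j

theorem coordMatrix_map (φ : A →+* B) (i : Fin d ↪o ι) :
    (coordMatrix A i).map φ = coordMatrix B i := by
  ext a l
  simp [coordMatrix, apply_ite φ]

theorem permMat_map (φ : A →+* B) (w : Equiv.Perm (Fin d)) :
    (permMat A w).map φ = permMat B w := by
  ext a l
  simp [permMat, apply_ite φ]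

theorem act_rowSpan (g : Matrix ι ι A) (X : Matrix (Fin d) ι A) :
    act g (rowSpan X) = rowSpan (X * g.transpose) := by
  rw [act, rowSpan, rowSpan, Submodule.map_span, ← Set.range_comp]
  congr 2
  ext a l
  simp [Matrix.mulVec, Matrix.mul_apply, dotProduct, mul_comm]

theorem extendScalars_act_rowSpan (φ : A →+* B) (g : Matrix ι ι A) (X : Matrix (Fin d) ι A) :
    extendScalars φ (act g (rowSpan X)) = act (g.map φ) (rowSpan (X.map φ)) := by
  rw [act_rowSpan, act_rowSpan, extendScalars_rowSpan, Matrix.map_mul, Matrix.transpose_map]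

theorem posCellPoints_extend (φ : A →+* B) (i : Fin d ↪o ι) {W : Submodule A (ι → A)}
    (hW : W ∈ posCellPoints A i) : extendScalars φ W ∈ posCellPoints B i := by
  obtain ⟨g, hg, rfl⟩ := hW
  exact ⟨Matrix.GeneralLinearGroup.map φ g, hg.map φ, by
    rw [extendScalars_act_rowSpan, coordMatrix_map]; rfl⟩

theorem negCellPoints_extend (φ : A →+* B) (i : Fin d ↪o ι) {W : Submodule A (ι → A)}
    (hW : W ∈ negCellPoints A i) : extendScalars φ W ∈ negCellPoints B i := by
  obtain ⟨g, hg, rfl⟩ := hW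
  exact ⟨Matrix.GeneralLinearGroup.map φ g, hg.map φ, by
    rw [extendScalars_act_rowSpan, coordMatrix_map]; rfl⟩

theorem bruhatPoints_map (φ : A →+* B) (w : Equiv.Perm (Fin d)) {M : Matrix (Fin d) (Fin d) A}
    (hM : M ∈ bruhatPoints A w) : M.map φ ∈ bruhatPoints B w := by
  obtain ⟨b, c, hb, hc, rfl⟩ := hM
  refine ⟨Matrix.GeneralLinearGroup.map φ b, Matrix.GeneralLinearGroup.map φ c,
    hb.map φ, hc.map φ, ?_⟩
  rw [Matrix.map_mul, Matrix.map_mul, permMat_map]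
  rfl

theorem baseChangeMatrix_map (φ : A →+* B) (i j : Fin d ↪o ι) (X : Matrix (Fin d) ι A)
    (hX : IsUnit (X.submatrix id i)) :
    IsUnit ((X.map φ).submatrix id i) ∧
      baseChangeMatrix i j (X.map φ) = (baseChangeMatrix i j X).map φ := by
  obtain ⟨g, hg⟩ := hX
  have h1 : (X.map φ).submatrix id i = (Matrix.GeneralLinearGroup.map φ g).val := by
    rw [Matrix.submatrix_map, ← hg]; rfl
  refine ⟨⟨_, h1.symm⟩, ?_⟩
  rw [baseChangeMatrix, baseChangeMatrix, Matrix.map_mul, h1, ← hg, ← Matrix.coe_units_inv,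
    ← Matrix.coe_units_inv, ← map_inv]
  rfl

/-- The translates of `[e_I]`, hence all points of the Bruhat cells, are `A`-points of the
Grassmannian `Gr(d, ι)` of rank `d` subspaces, i.e. of corank `|ι| - d` ones. -/
theorem exists_grassmannian (g : GL ι A) (i : Fin d ↪o ι) :
    ∃ N : Module.Grassmannian A (ι → A) (Fintype.card ι - d),
      N.toSubmodule = act g.val (rowSpan (coordMatrix A i)) := by
  classical
  let σ := {l : ι // l ∉ Set.range i}
  let p : (ι → A) →ₗ[A] (σ → A) := LinearMap.funLeft A A Subtype.val
  have hp : Function.Surjective p :=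
    LinearMap.funLeft_surjective_of_injective A A _ Subtype.val_injective
  have hrow : ∀ a, (coordMatrix A i).row a = Pi.single (i a) 1 := by
    intro a; ext l; simp [coordMatrix, Pi.single_apply]
  have hker : LinearMap.ker p = rowSpan (coordMatrix A i) := by
    apply le_antisymm
    · intro v hv
      have : v = ∑ l, v l • (Pi.single l 1 : ι → A) := by
        ext m; simp [Pi.single_apply]
      rw [this]
      refine Submodule.sum_mem _ fun l _ => ?_
      by_cases hl : l ∈ Set.range i
      · obtain ⟨a, rfl⟩ := hl
        exact Submodule.smul_mem _ _ (Submodule.subset_span ⟨a, hrow a⟩)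
      · have : v l = 0 := congrFun (LinearMap.mem_ker.1 hv) ⟨l, hl⟩
        simp [this]
    · refine Submodule.span_le.2 ?_
      rintro _ ⟨a, rfl⟩
      rw [hrow]
      refine LinearMap.mem_ker.2 (funext fun l => ?_)
      have : l.1 ≠ i a := fun e => l.2 ⟨a, e.symm⟩
      simp [p, LinearMap.funLeft_apply, this]
  let G : (ι → A) ≃ₗ[A] (ι → A) := LinearMap.GeneralLinearGroup.toLinearEquiv
    (Matrix.GeneralLinearGroup.toLin g)
  have hG : act g.val (rowSpan (coordMatrix A i)) =
      (rowSpan (coordMatrix A i)).map (G : (ι → A) →ₗ[A] (ι → A)) := rfl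
  let e : ((ι → A) ⧸ act g.val (rowSpan (coordMatrix A i))) ≃ₗ[A] (σ → A) :=
    (Submodule.Quotient.equiv _ _ G hG.symm).symm.trans
      ((Submodule.quotEquivOfEq _ _ hker.symm).trans (p.quotKerEquivOfSurjective hp))
  refine ⟨⟨_, Module.Finite.equiv e.symm, Module.Projective.of_equiv e.symm, fun q => ?_⟩, rfl⟩
  have := q.nontrivial
  rw [Module.rankAtStalk_eq_of_equiv e, Module.rankAtStalk_eq_finrank_of_free]
  simp only [Pi.natCast_apply, Module.finrank_fintype_fun_eq_card]
  have h2 : Fintype.card {l : ι // l ∈ Set.range i} = d := by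
    have := Fintype.card_congr (Equiv.ofInjective i i.injective)
    rw [Fintype.card_fin] at this
    exact (Fintype.card_congr (Equiv.refl _)).trans this.symm
  have := Fintype.card_subtype_compl (fun l : ι => l ∈ Set.range i)
  rw [h2] at this
  simpa [σ] using this

/-- The base change matrix depends only on the row span. -/
theorem baseChangeMatrix_congr (i j : Fin d ↪o ι) (X Y : Matrix (Fin d) ι A) (h : rowSpan X = rowSpan Y)
    (hX : IsUnit (X.submatrix id i)) : IsUnit (Y.submatrix id i) ∧
      baseChangeMatrix i j X = baseChangeMatrix i j Y := by
  have hc : ∃ c : Matrix (Fin d) (Fin d) A, X = c * Y := by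
    have : ∀ a, ∃ c : Fin d → A, ∑ b, c b • Y.row b = X.row a := fun a =>
      (Submodule.mem_span_range_iff_exists_fun A).1
        (h.le (Submodule.subset_span ⟨a, rfl⟩ : X.row a ∈ rowSpan X))
    choose c hc using this
    refine ⟨Matrix.of c, ?_⟩
    ext a l
    simpa [Matrix.mul_apply] using (congrFun (hc a) l).symm
  obtain ⟨c, rfl⟩ := hc
  have hs : ∀ f : Fin d ↪o ι, (c * Y).submatrix id f = c * Y.submatrix id f := fun f => rfl
  rw [hs, Matrix.isUnit_iff_isUnit_det, Matrix.det_mul, IsUnit.mul_iff] at hX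
  refine ⟨(Matrix.isUnit_iff_isUnit_det _).2 hX.2, ?_⟩
  rw [baseChangeMatrix, baseChangeMatrix, hs, hs, Matrix.mul_inv_rev, Matrix.mul_assoc,
    ← Matrix.mul_assoc c⁻¹, Matrix.nonsing_inv_mul _ hX.1, Matrix.one_mul]

end Points

/-! ### Richardson varieties and their strata as functors of points

A variety over `F` is described by its functor of points on commutative `F`-algebras; morphisms of
varieties are natural transformations. -/

section Functors

variable (F : Type u) [Field F] {ι : Type} [Fintype ι] [LinearOrder ι] {d : ℕ}

/-- The functor `A ↦ {submodules of A^{1 × ι}}`, which contains all Grassmannians of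
`F^{1 × ι}` as subfunctors. -/
def subspaces (ι : Type) : CommAlgCat.{u} F ⥤ Type u where
  obj A := Submodule A (ι → A)
  map f := ↾fun W => extendScalars f.hom.toRingHom W
  map_id A := by
    refine ConcreteCategory.hom_ext _ _ fun W => ?_
    exact extendScalars_id W
  map_comp f g := by
    refine ConcreteCategory.hom_ext _ _ fun W => ?_
    exact extendScalars_comp g.hom.toRingHom f.hom.toRingHom W

/-- The positive Bruhat cell `Z_I⁺`. -/
def posCell (i : Fin d ↪o ι) : Subfunctor (subspaces F ι) where
  obj A := posCellPoints A i
  map f _ hW := posCellPoints_extend f.hom.toRingHom i hW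

/-- The negative Bruhat cell `Z_I⁻`. -/
def negCell (i : Fin d ↪o ι) : Subfunctor (subspaces F ι) where
  obj A := negCellPoints A i
  map f _ hW := negCellPoints_extend f.hom.toRingHom i hW

/-- The open Richardson variety `R_{I,J} = Z_I⁻ ∩ Z_J⁺`. -/
def richardson (i j : Fin d ↪o ι) : CommAlgCat.{u} F ⥤ Type u :=
  (negCell F i ⊓ posCell F j).toFunctor

/-- The Deodhar-type stratum `R_{I,J}^w`: the preimage of `B w B` under the base change map
`R_{I,J} → GL_d`, `[X] ↦ (X_{[d] × I})⁻¹ X_{[d] × J}`. The matrix `X_{[d] × I}` is automatically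
invertible, and the value does not depend on the matrix `X` that represents a point. -/
def stratum (i j : Fin d ↪o ι) (w : Equiv.Perm (Fin d)) : Subfunctor (richardson F i j) where
  obj A := {W | ∃ X : Matrix (Fin d) ι A, rowSpan X = W.1 ∧ IsUnit (X.submatrix id i) ∧
    baseChangeMatrix i j X ∈ bruhatPoints A w}
  map {A B} f := by
    rintro W ⟨X, hX, hu, hw⟩
    have h := baseChangeMatrix_map f.hom.toRingHom i j X hu
    refine ⟨X.map f.hom.toRingHom, ?_, h.1, ?_⟩
    · rw [← extendScalars_rowSpan, hX]
      rfl
    · rw [h.2]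
      exact bruhatPoints_map _ w hw

/-- Affine space `𝔸^r`. -/
def affineSpace (r : ℕ) : CommAlgCat.{u} F ⥤ Type u where
  obj A := Fin r → A
  map f := ↾fun v => f.hom ∘ v

end Functors

/-! ### Vector bundles -/

section VectorBundle

variable {F : Type u} [Field F] {E S : CommAlgCat.{u} F ⥤ Type u}

/-- Open subfunctors: the pullback of `U` along every `A`-point `Spec A → S` is the open complement
of the vanishing locus of some ideal of `A`. -/
def IsOpenSubfunctor (U : Subfunctor S) : Prop :=
  ∀ (A : CommAlgCat.{u} F) (x : S.obj A), ∃ a : Ideal A, ∀ (B : CommAlgCat.{u} F) (f : A ⟶ B),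
    S.map f x ∈ U.obj B ↔ a.map f.hom.toRingHom = ⊤

/-- A trivialization of rank `r` of `ρ : E → S` over an open `base ⊂ S`: a morphism
`coord : ρ⁻¹(base) → 𝔸^r` such that `(ρ, coord) : ρ⁻¹(base) → base × 𝔸^r` is an isomorphism. -/
structure LocalTrivialization (ρ : E ⟶ S) (r : ℕ) where
  /-- The open set over which the bundle is trivialized. -/
  base : Subfunctor S
  isOpen : IsOpenSubfunctor base
  /-- The linear fibre coordinates. -/
  coord : (base.preimage ρ).toFunctor ⟶ affineSpace F r
  bijective : ∀ A : CommAlgCat.{u} F, Function.Bijective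
    (fun x : (base.preimage ρ).toFunctor.obj A =>
      (((base.fromPreimage ρ).app A x, coord.app A x) :
        base.toFunctor.obj A × (affineSpace F r).obj A))

/-- `ρ : E → S` is a (Zariski locally trivial) vector bundle of rank `r`: `S` is covered by open
sets over which `ρ` has trivializations of rank `r`, and any two of these differ on overlaps by an
invertible matrix acting linearly on the fibres. A family of open subfunctors is a cover if
every point over a field lies in one of them. -/
def IsVectorBundle (ρ : E ⟶ S) (r : ℕ) : Prop :=
  ∃ (κ : Type u) (t : κ → LocalTrivialization ρ r),
    (∀ K : CommAlgCat.{u} F, IsField K → ∀ y : S.obj K, ∃ a, y ∈ (t a).base.obj K) ∧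
    ∀ (a b : κ) (A : CommAlgCat.{u} F) (y : S.obj A),
      y ∈ (t a).base.obj A → y ∈ (t b).base.obj A →
      ∃ g : GL (Fin r) A, ∀ (x : E.obj A) (ha : ρ.app A x ∈ (t a).base.obj A)
        (hb : ρ.app A x ∈ (t b).base.obj A), ρ.app A x = y →
        ((t b).coord.app A ⟨x, hb⟩ : Fin r → A) =
          g.val.mulVec ((t a).coord.app A ⟨x, ha⟩ : Fin r → A)

end VectorBundle

/-! ### Removing a common element -/

section Removal

variable {ι : Type} [LinearOrder ι] {d : ℕ}

/-- The set `I' = I \ {c}`, as a subset of the index set with `c` removed, where `c = i_k` is the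
`k`-th element of `I`. -/
def removeElem (i : Fin (d + 1) ↪o ι) (k : Fin (d + 1)) (c : ι) (h : i k = c) :
    Fin d ↪o {l : ι // l ≠ c} :=
  OrderEmbedding.ofStrictMono
    (fun a => ⟨i (k.succAbove a), fun e => k.succAbove_ne a (i.injective (e.trans h.symm))⟩)
    (fun _ _ hab => i.strictMono (k.strictMono_succAbove hab))

/-- The restriction of a permutation `w` of `[d+1]` to a bijection `[d+1] \ {k'} → [d+1] \ {w k'}`,
as a permutation of `[d]` after renumbering both sides increasingly. -/
def restrictPerm (w : Equiv.Perm (Fin (d + 1))) (k' : Fin (d + 1)) : Equiv.Perm (Fin d) :=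
  ((finSuccAboveEquiv k').trans
    (w.subtypeEquiv fun a => (w.injective.ne_iff (x := a) (y := k')).symm)).trans
    (finSuccAboveEquiv (w k')).symm

end Removal

end Richardson

namespace Richardson

/-! ### Triangular matrices -/

section Triangular

variable {A : Type u} [CommRing A] {ι α : Type} [Fintype ι] [DecidableEq ι] [LinearOrder α]
  {T : ι → α}

/-! A point W of R_{I,J} has a unique reduced echelon basis X with pivots I, whose row a is
supported in columns ≥ i_a, and a unique one Y with pivots J, whose row a is supported in columns ≤
j_a. The morphism ρ sends W to W' = W ∩ {v_c = 0}. Since c is a pivot of both forms, deleting column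
c and the row with pivot c from X and from Y gives echelon bases X', Y' of W', so W' lies in
R_{I',J'}. Fibres: let x and y be the rows of X and Y with pivot c. Then y - x has c-coordinate 0,
so y - x = uX' for a unique u, and u_a is the value of y at the a-th element of I'. As x lives in
columns ≥ c and y in columns ≤ c, uX' equals y left of c and -x right of c, so u recovers W. The
constraints on u are linear: u_a = 0 when the a-th element of I' exceeds c, and (uM')_b = 0 when the
b-th element of J' lies below c, with M' = X'_{J'} the base change matrix of W'. Conversely, cutting
such a uX' at c gives x and y (`exists_of_mem_fibre`). Rank: the inverse of M' is Y'_{I'}, and its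
rows with pivot below c vanish at the elements of I' above c. Pairing with these rows shows that the
equations are independent over a field (`exists_isUnit_chartDet`), which leaves k - k' dimensions.
Suitable entries of u are fibre coordinates wherever a determinant is a unit. Strata: the base
change matrix M' is M without row k and column k'. Column k' of M is the k-th standard vector and
row k vanishes left of k', so M lies in the double coset of w exactly when M' lies in that of w'. -/

theorem det_of_blockTriangular_injective (hT : Function.Injective T) {M : Matrix ι ι A}
    (hM : M.BlockTriangular T) : M.det = ∏ l, M l l := by
  -- An injective `T` reorders the indices so that block triangular means triangular; `id` and
  -- `OrderDual.toDual` then treat the two Borel subgroups uniformly.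
  let : LinearOrder ι := LinearOrder.lift' T hT
  have h : M.IsUpperTriangular := fun a b hab => hM hab
  convert Matrix.det_of_isUpperTriangular h

theorem isUnit_apply_self_of_blockTriangular (hT : Function.Injective T) {M : Matrix ι ι A}
    (hM : M.BlockTriangular T) (hu : IsUnit M) (l : ι) : IsUnit (M l l) := by
  rw [Matrix.isUnit_iff_isUnit_det, det_of_blockTriangular_injective hT hM] at hu
  exact IsUnit.prod_univ_iff.1 hu l

theorem isUnit_of_blockTriangular (hT : Function.Injective T) {M : Matrix ι ι A}
    (hM : M.BlockTriangular T) (hd : ∀ l, IsUnit (M l l)) : IsUnit M := by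
  rw [Matrix.isUnit_iff_isUnit_det, det_of_blockTriangular_injective hT hM]
  exact IsUnit.prod_univ_iff.2 hd

end Triangular

/-! ### Echelon forms of points of Bruhat cells -/

section Echelon

variable {A B : Type u} [CommRing A] [CommRing B] {ι α : Type} [LinearOrder α]
  {d : ℕ} {T : ι → α} {i : Fin d → ι}

/-- `X` is in reduced echelon form with pivots `i`: its entries in row `a` vanish beyond column
`i a`, for the order on columns pulled back along `T`, and its pivot columns form the identity. -/
structure IsEchelon (T : ι → α) (i : Fin d → ι) (X : Matrix (Fin d) ι A) : Prop where
  pivot : X.submatrix id i = 1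
  vanish : ∀ a l, T (i a) < T l → X a l = 0

theorem IsEchelon.apply_pivot {X : Matrix (Fin d) ι A} (h : IsEchelon T i X) (a b : Fin d) :
    X a (i b) = if a = b then 1 else 0 := by
  rw [← Matrix.one_apply, ← h.pivot]; rfl

theorem IsEchelon.map {X : Matrix (Fin d) ι A} (h : IsEchelon T i X) (φ : A →+* B) :
    IsEchelon T i (X.map φ) where
  pivot := by
    rw [Matrix.submatrix_map, h.pivot]
    ext a b
    simp [Matrix.one_apply, apply_ite φ]
  vanish a l hl := by simp [h.vanish a l hl]

theorem exists_mul_of_rowSpan_le {e : ℕ} {X : Matrix (Fin e) ι A} {Y : Matrix (Fin d) ι A}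
    (h : rowSpan X ≤ rowSpan Y) : ∃ c : Matrix (Fin e) (Fin d) A, X = c * Y := by
  have : ∀ a, ∃ c : Fin d → A, ∑ b, c b • Y.row b = X.row a := fun a =>
    (Submodule.mem_span_range_iff_exists_fun A).1
      (h (Submodule.subset_span ⟨a, rfl⟩ : X.row a ∈ rowSpan X))
  choose c hc using this
  refine ⟨Matrix.of c, ?_⟩
  ext a l
  simpa [Matrix.mul_apply] using (congrFun (hc a) l).symm

theorem mem_rowSpan {X : Matrix (Fin d) ι A} {v : ι → A} :
    v ∈ rowSpan X ↔ ∃ u : Fin d → A, v = Matrix.vecMul u X := by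
  rw [rowSpan, Submodule.mem_span_range_iff_exists_fun]
  refine exists_congr fun u => ?_
  rw [eq_comm]
  have : ∑ b, u b • X.row b = Matrix.vecMul u X := by
    ext l; simp [Matrix.vecMul, dotProduct]
  rw [this]

theorem rowSpan_mul_le {e : ℕ} (c : Matrix (Fin e) (Fin d) A) (Y : Matrix (Fin d) ι A) :
    rowSpan (c * Y) ≤ rowSpan Y := by
  refine Submodule.span_le.2 ?_
  rintro _ ⟨a, rfl⟩
  exact mem_rowSpan.2 ⟨c a, by ext l; simp [Matrix.mul_apply, Matrix.vecMul, dotProduct]⟩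

/-- A matrix whose columns at `i` form the identity expresses the coefficients of every vector in
its row span. -/
theorem eq_mul_of_rowSpan_le {e : ℕ} {X : Matrix (Fin e) ι A} {Y : Matrix (Fin d) ι A}
    (h : rowSpan X ≤ rowSpan Y) (hY : Y.submatrix id i = 1) : X = X.submatrix id i * Y := by
  obtain ⟨c, rfl⟩ := exists_mul_of_rowSpan_le h
  have : (c * Y).submatrix id i = c * Y.submatrix id i := rfl
  rw [this, hY, Matrix.mul_one]

/-- The pivot columns read off coefficients, so the change of basis is the identity. This uniqueness
makes echelon forms compatible with extension of scalars. -/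
theorem IsEchelon.eq_of_rowSpan_eq {X Y : Matrix (Fin d) ι A} (hX : IsEchelon T i X)
    (hY : IsEchelon T i Y) (h : rowSpan X = rowSpan Y) : X = Y := by
  rw [eq_mul_of_rowSpan_le h.le hY.pivot, hX.pivot, Matrix.one_mul]

variable [Fintype ι] [LinearOrder ι]

theorem coordMatrix_mul_transpose (i : Fin d ↪o ι) (g : Matrix ι ι A) :
    coordMatrix A i * g.transpose = Matrix.of fun a l => g l (i a) := by
  ext a l
  simp [coordMatrix, Matrix.mul_apply]

/-- The pivot block of the translated basis is triangular with unit diagonal; multiplying by its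
inverse, again triangular, normalises the pivots without enlarging the supports. -/
theorem exists_isEchelon (hT : Function.Injective T) (i : Fin d ↪o ι) (g : GL ι A)
    (hg : g.val.BlockTriangular T) :
    ∃ X, IsEchelon T i X ∧ rowSpan X = act g.val (rowSpan (coordMatrix A i)) := by
  rw [act_rowSpan, coordMatrix_mul_transpose]
  set Z : Matrix (Fin d) ι A := Matrix.of fun a l => g.val l (i a) with hZ
  set U : Matrix (Fin d) (Fin d) A := Z.submatrix id i with hU
  have hTi : Function.Injective (OrderDual.toDual ∘ T ∘ i) :=
    OrderDual.toDual.injective.comp (hT.comp i.injective)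
  -- The rows of `Z` are columns of `g`, and this transposition reverses the direction of
  -- triangularity.
  have hUt : U.BlockTriangular (OrderDual.toDual ∘ T ∘ i) := fun a b hab => hg hab
  have hUu : IsUnit U := isUnit_of_blockTriangular hTi hUt fun a =>
    isUnit_apply_self_of_blockTriangular hT hg g.isUnit (i a)
  obtain ⟨V, hV⟩ := hUu
  let : Invertible U := hV ▸ V.invertible
  have hit := Matrix.blockTriangular_inv_of_blockTriangular hUt
  have hdet := (Matrix.isUnit_iff_isUnit_det U).1 ⟨V, hV⟩
  refine ⟨U⁻¹ * Z, ⟨?_, fun a l hl => ?_⟩, le_antisymm (rowSpan_mul_le _ _) ?_⟩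
  · exact Matrix.nonsing_inv_mul _ hdet
  · rw [Matrix.mul_apply]
    refine Finset.sum_eq_zero fun b _ => ?_
    by_cases hb : T (i a) < T (i b)
    · rw [hit (i := a) (j := b) hb, zero_mul]
    · rw [hZ, Matrix.of_apply, hg (lt_of_le_of_lt (not_lt.1 hb) hl), mul_zero]
  · have : Z = U * (U⁻¹ * Z) := by
      rw [← Matrix.mul_assoc, Matrix.mul_nonsing_inv _ hdet, Matrix.one_mul]
    conv_lhs => rw [this]
    exact rowSpan_mul_le _ _

theorem IsEchelon.exists_act (hT : Function.Injective T) {i : Fin d ↪o ι}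
    {X : Matrix (Fin d) ι A} (hX : IsEchelon T i X) :
    ∃ g : GL ι A, g.val.BlockTriangular T ∧ rowSpan X = act g.val (rowSpan (coordMatrix A i)) := by
  classical
  -- The identity matrix with its pivot columns replaced by the rows of `X`.
  let M : Matrix ι ι A := Matrix.of fun l m =>
    if h : m ∈ Set.range i then X h.choose l else if l = m then 1 else 0
  have hMi : ∀ l a, M l (i a) = X a l := by
    intro l a
    have h : i a ∈ Set.range i := ⟨a, rfl⟩
    have : h.choose = a := i.injective h.choose_spec
    simp only [M, Matrix.of_apply]
    rw [dif_pos h, this]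
  have hMo : ∀ l m, m ∉ Set.range i → M l m = if l = m then 1 else 0 := by
    intro l m h
    simp only [M, Matrix.of_apply]
    rw [dif_neg h]
  have hM : M.BlockTriangular T := by
    intro l m hlm
    by_cases h : m ∈ Set.range i
    · obtain ⟨a, rfl⟩ := h
      rw [hMi, hX.vanish a l hlm]
    · rw [hMo _ _ h, if_neg]
      rintro rfl
      exact lt_irrefl _ hlm
  have hMd : ∀ l, IsUnit (M l l) := by
    intro l
    by_cases h : l ∈ Set.range i
    · obtain ⟨a, rfl⟩ := h
      rw [hMi, hX.apply_pivot, if_pos rfl]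
      exact isUnit_one
    · rw [hMo _ _ h, if_pos rfl]
      exact isUnit_one
  obtain ⟨g, hg⟩ := isUnit_of_blockTriangular hT hM hMd
  refine ⟨g, hg ▸ hM, ?_⟩
  rw [act_rowSpan, coordMatrix_mul_transpose, hg]
  congr 1
  ext a l
  exact (hMi l a).symm

theorem mem_negCellPoints {i : Fin d ↪o ι} {W : Submodule A (ι → A)} :
    W ∈ negCellPoints A i ↔ ∃ X, IsEchelon OrderDual.toDual i X ∧ rowSpan X = W := by
  constructor
  · rintro ⟨g, hg, rfl⟩
    exact exists_isEchelon OrderDual.toDual.injective i g hg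
  · rintro ⟨X, hX, rfl⟩
    exact hX.exists_act OrderDual.toDual.injective

theorem mem_posCellPoints {i : Fin d ↪o ι} {W : Submodule A (ι → A)} :
    W ∈ posCellPoints A i ↔ ∃ X, IsEchelon id i X ∧ rowSpan X = W := by
  constructor
  · rintro ⟨g, hg, rfl⟩
    exact exists_isEchelon Function.injective_id i g hg
  · rintro ⟨X, hX, rfl⟩
    exact hX.exists_act Function.injective_id

end Echelon

/-! ### Deleting a row and a column in a Bruhat double coset -/

section Bruhat

variable {A : Type u} [CommRing A] {d : ℕ}

theorem succAbove_restrictPerm (w : Equiv.Perm (Fin (d + 1))) (k' : Fin (d + 1)) (b : Fin d) :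
    (w k').succAbove (restrictPerm w k' b) = w (k'.succAbove b) := by
  have h := (finSuccAboveEquiv (w k')).apply_symm_apply
    ((w.subtypeEquiv fun a => (w.injective.ne_iff (x := a) (y := k')).symm)
      (finSuccAboveEquiv k' b))
  exact congrArg Subtype.val h

theorem mul_permMat_mul_apply (w : Equiv.Perm (Fin d)) (b c : Matrix (Fin d) (Fin d) A)
    (x y : Fin d) : (b * permMat A w * c) x y = ∑ m, b x (w m) * c m y := by
  simp [Matrix.mul_apply, permMat]

/-- A triangular matrix is invertible exactly when its diagonal entries are units, so factors can be
built entry by entry. -/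
theorem bruhatPoints_iff {w : Equiv.Perm (Fin d)} {M : Matrix (Fin d) (Fin d) A} :
    M ∈ bruhatPoints A w ↔ ∃ b c : Matrix (Fin d) (Fin d) A,
      b.IsUpperTriangular ∧ c.IsUpperTriangular ∧ (∀ x, IsUnit (b x x)) ∧
      (∀ x, IsUnit (c x x)) ∧ ∀ x y, M x y = ∑ m, b x (w m) * c m y := by
  constructor
  · rintro ⟨b, c, hb, hc, rfl⟩
    exact ⟨b, c, hb, hc, isUnit_apply_self_of_blockTriangular Function.injective_id hb b.isUnit,
      isUnit_apply_self_of_blockTriangular Function.injective_id hc c.isUnit,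
      mul_permMat_mul_apply w _ _⟩
  · rintro ⟨b, c, hb, hc, hb', hc', hM⟩
    obtain ⟨b, rfl⟩ := isUnit_of_blockTriangular Function.injective_id hb hb'
    obtain ⟨c, rfl⟩ := isUnit_of_blockTriangular Function.injective_id hc hc'
    refine ⟨b, c, hb, hc, ?_⟩
    ext x y
    rw [hM, mul_permMat_mul_apply]

/-- Vanishing of column k' outside row k expresses column k of b through its other columns.
Eliminating it turns c into its Schur complement at (k', k'), while b only loses a row and a column.
-/
theorem bruhatPoints_submatrix {w : Equiv.Perm (Fin (d + 1))} {k k' : Fin (d + 1)} (hw : w k' = k)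
    {M : Matrix (Fin (d + 1)) (Fin (d + 1)) A} (hcol : ∀ a, M (k.succAbove a) k' = 0)
    (hM : M ∈ bruhatPoints A w) :
    M.submatrix k.succAbove k'.succAbove ∈ bruhatPoints A (restrictPerm w k') := by
  subst hw
  obtain ⟨b, c, hb, hc, hb', hc', hM⟩ := bruhatPoints_iff.1 hM
  obtain ⟨t, ht⟩ := (hc' k').exists_right_inv
  refine bruhatPoints_iff.2 ⟨b.submatrix (w k').succAbove (w k').succAbove,
    Matrix.of fun x y => c (k'.succAbove x) (k'.succAbove y) -
      c (k'.succAbove x) k' * t * c k' (k'.succAbove y), ?_, ?_, fun x => hb' _, ?_, ?_⟩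
  · exact fun x y hxy => hb (Fin.strictMono_succAbove _ hxy)
  -- The Schur correction needs row ≤ k' ≤ column to be nonzero; with k' itself removed, it lives
  -- strictly above the diagonal.
  · intro x y hxy
    have hxy' : k'.succAbove y < k'.succAbove x := Fin.strictMono_succAbove _ hxy
    rw [Matrix.of_apply, hc (i := k'.succAbove x) (j := k'.succAbove y) hxy']
    rcases lt_or_ge k' (k'.succAbove x) with h | h
    · rw [hc (i := k'.succAbove x) (j := k') h]; simp
    · rw [hc (i := k') (j := k'.succAbove y) (lt_of_lt_of_le hxy' h)]; simp
  · intro x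
    rw [Matrix.of_apply]
    rcases lt_or_gt_of_ne (k'.succAbove_ne x) with h | h
    · rw [hc (i := k') (j := k'.succAbove x) h]; simpa using hc' _
    · rw [hc (i := k'.succAbove x) (j := k') h]; simpa using hc' _
  · intro x y
    have h0 := hcol x
    rw [hM, Fin.sum_univ_succAbove _ k'] at h0
    rw [Matrix.submatrix_apply, hM, Fin.sum_univ_succAbove _ k']
    simp only [Matrix.submatrix_apply, Matrix.of_apply, succAbove_restrictPerm, mul_sub,
      Finset.sum_sub_distrib]
    have h1 : ∑ m, b ((w k').succAbove x) (w (k'.succAbove m)) *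
        (c (k'.succAbove m) k' * t * c k' (k'.succAbove y)) =
        (∑ m, b ((w k').succAbove x) (w (k'.succAbove m)) * c (k'.succAbove m) k') *
          (t * c k' (k'.succAbove y)) := by
      rw [Finset.sum_mul]
      exact Finset.sum_congr rfl fun m _ => by ring
    rw [h1, eq_neg_of_add_eq_zero_right h0]
    linear_combination (-(b ((w k').succAbove x) (w k') * c k' (k'.succAbove y))) * ht

/-- Border b by an identity row and column at k, and c by row k of M and an otherwise zero column at
k'. The bordered c is triangular because row k of M starts with its entry 1 at k'. -/
theorem bruhatPoints_of_submatrix {w : Equiv.Perm (Fin (d + 1))} {k k' : Fin (d + 1)}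
    (hw : w k' = k) {M : Matrix (Fin (d + 1)) (Fin (d + 1)) A}
    (hcol : ∀ a, M (k.succAbove a) k' = 0) (hkk : M k k' = 1) (hrow : ∀ b < k', M k b = 0)
    (hM : M.submatrix k.succAbove k'.succAbove ∈ bruhatPoints A (restrictPerm w k')) :
    M ∈ bruhatPoints A w := by
  subst hw
  obtain ⟨b, c, hb, hc, hb', hc', hM⟩ := bruhatPoints_iff.1 hM
  let b₁ : Matrix (Fin (d + 1)) (Fin (d + 1)) A := Matrix.of
    ((w k').insertNth (Pi.single (w k') 1) fun x => (w k').insertNth 0 (b x))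
  let c₁ : Matrix (Fin (d + 1)) (Fin (d + 1)) A := Matrix.of
    (k'.insertNth (M (w k')) fun x => k'.insertNth 0 (c x))
  have b1 : ∀ y, b₁ (w k') y = (Pi.single (w k') 1 : Fin (d + 1) → A) y := fun y => by simp [b₁]
  have b2 : ∀ x, b₁ ((w k').succAbove x) (w k') = 0 := fun x => by simp [b₁]
  have b3 : ∀ x y, b₁ ((w k').succAbove x) ((w k').succAbove y) = b x y := fun x y => by simp [b₁]
  have c1 : ∀ y, c₁ k' y = M (w k') y := fun y => by simp [c₁]
  have c2 : ∀ x, c₁ (k'.succAbove x) k' = 0 := fun x => by simp [c₁]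
  have c3 : ∀ x y, c₁ (k'.succAbove x) (k'.succAbove y) = c x y := fun x y => by simp [c₁]
  refine bruhatPoints_iff.2 ⟨b₁, c₁, ?_, ?_, ?_, ?_, ?_⟩
  · intro x y hxy
    simp only [id] at hxy
    induction x using (w k').succAboveCases with
    | x => rw [b1, Pi.single_apply, if_neg hxy.ne]
    | p x =>
      induction y using (w k').succAboveCases with
      | x => exact b2 x
      | p y => rw [b3]; exact hb ((Fin.strictMono_succAbove _).lt_iff_lt.1 hxy)
  · intro x y hxy
    simp only [id] at hxy
    induction x using k'.succAboveCases with
    | x => rw [c1]; exact hrow y hxy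
    | p x =>
      induction y using k'.succAboveCases with
      | x => exact c2 x
      | p y => rw [c3]; exact hc ((Fin.strictMono_succAbove _).lt_iff_lt.1 hxy)
  · intro x
    induction x using (w k').succAboveCases with
    | x => rw [b1]; simp
    | p x => rw [b3]; exact hb' x
  · intro x
    induction x using k'.succAboveCases with
    | x => rw [c1, hkk]; exact isUnit_one
    | p x => rw [c3]; exact hc' x
  · intro x y
    rw [Fin.sum_univ_succAbove _ k']
    simp only [← succAbove_restrictPerm]
    induction x using (w k').succAboveCases with
    | x => simp [b1, c1]
    | p x =>
      rw [b2, zero_mul, zero_add]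
      simp only [b3]
      induction y using k'.succAboveCases with
      | x => simp [c2, hcol]
      | p y => simpa [c3] using hM x y

end Bruhat

/-! ### Removing a pivot row and column -/

section InsertCoord

variable {A : Type u} {ι : Type} [DecidableEq ι]

/-- The vector with coordinate `t` at `c` and the other coordinates given by `v`. -/
def insertCoord (c : ι) (t : A) (v : {l : ι // l ≠ c} → A) : ι → A :=
  fun l => if h : l = c then t else v ⟨l, h⟩

@[simp] theorem insertCoord_self (c : ι) (t : A) (v : {l : ι // l ≠ c} → A) :
    insertCoord c t v c = t := by simp [insertCoord]

@[simp] theorem insertCoord_val {c : ι} (t : A) (v : {l : ι // l ≠ c} → A) (l : {l : ι // l ≠ c}) :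
    insertCoord c t v l.1 = v l := by simp [insertCoord, l.2]

end InsertCoord

section Deletion

variable {A B : Type u} [CommRing A] [CommRing B] {ι : Type} {d : ℕ}

/-- The intersection of a subspace with the hyperplane `v c = 0`, as a space of vectors without
the coordinate `c`. -/
def deleteCoord (c : ι) (W : Submodule A (ι → A)) : Submodule A ({l : ι // l ≠ c} → A) :=
  (W ⊓ LinearMap.ker (LinearMap.proj c)).map (LinearMap.funLeft A A Subtype.val)

theorem mem_deleteCoord {c : ι} {W : Submodule A (ι → A)} {v : {l : ι // l ≠ c} → A} :
    v ∈ deleteCoord c W ↔ ∃ w ∈ W, w c = 0 ∧ ∀ l, v l = w l.1 := by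
  constructor
  · rintro ⟨w, ⟨hw, hc⟩, rfl⟩
    exact ⟨w, hw, hc, fun l => rfl⟩
  · rintro ⟨w, hw, hc, hv⟩
    exact ⟨w, ⟨hw, hc⟩, funext fun l => (hv l).symm⟩

theorem vecMul_apply (u : Fin d → A) (X : Matrix (Fin d) ι A) (l : ι) :
    Matrix.vecMul u X l = ∑ a, u a * X a l := rfl

/-- The c-coordinate of uX is u_k, so the hyperplane section is spanned by the rows other than row
k. -/
theorem deleteCoord_rowSpan {c : ι} {k : Fin (d + 1)} {X : Matrix (Fin (d + 1)) ι A}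
    (hX : ∀ a, X a c = if a = k then 1 else 0) :
    deleteCoord c (rowSpan X) = rowSpan (X.submatrix k.succAbove Subtype.val) := by
  ext v
  rw [mem_deleteCoord, mem_rowSpan]
  constructor
  · rintro ⟨w, hw, hc, hv⟩
    obtain ⟨u, rfl⟩ := mem_rowSpan.1 hw
    have hk : u k = 0 := by simpa [vecMul_apply, hX] using hc
    refine ⟨fun a => u (k.succAbove a), ?_⟩
    ext l
    rw [hv, vecMul_apply, vecMul_apply, Fin.sum_univ_succAbove _ k, hk]
    simp
  · rintro ⟨u, rfl⟩
    refine ⟨_, mem_rowSpan.2 ⟨k.insertNth 0 u, rfl⟩, ?_, fun l => ?_⟩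
    · simp [vecMul_apply, hX]
    · rw [vecMul_apply, vecMul_apply, Fin.sum_univ_succAbove _ k]
      simp

variable [DecidableEq ι]

/-- The matrix `X` with a zero column inserted at `c` and the row `v`, extended by `1` at `c`,
inserted at `k`. -/
def insertRow (k : Fin (d + 1)) (c : ι) (X : Matrix (Fin d) {l : ι // l ≠ c} A)
    (v : {l : ι // l ≠ c} → A) : Matrix (Fin (d + 1)) ι A :=
  Matrix.of (k.insertNth (insertCoord c 1 v) fun a => insertCoord c 0 (X a))

variable {k : Fin (d + 1)} {c : ι} {X : Matrix (Fin d) {l : ι // l ≠ c} A}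
  {v : {l : ι // l ≠ c} → A}

@[simp] theorem insertRow_same (l : ι) : insertRow k c X v k l = insertCoord c 1 v l := by
  simp [insertRow]

@[simp] theorem insertRow_succAbove (a : Fin d) (l : ι) :
    insertRow k c X v (k.succAbove a) l = insertCoord c 0 (X a) l := by
  simp [insertRow]

theorem insertRow_submatrix : (insertRow k c X v).submatrix k.succAbove Subtype.val = X := by
  ext a l
  simp

theorem insertRow_apply_col (a : Fin (d + 1)) :
    insertRow k c X v a c = if a = k then 1 else 0 := by
  induction a using k.succAboveCases with
  | x => simp
  | p a => simp

theorem eq_insertRow {Z : Matrix (Fin (d + 1)) ι A} (hZ : ∀ a, Z a c = if a = k then 1 else 0) :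
    Z = insertRow k c (Z.submatrix k.succAbove Subtype.val) (fun l => Z k l.1) := by
  ext a l
  by_cases hl : l = c
  · subst hl
    rw [hZ, insertRow_apply_col]
  · lift l to {l : ι // l ≠ c} using hl
    induction a using k.succAboveCases with
    | x => simp
    | p a => simp

/-- Subtracting w_c times the inserted row kills the coordinate c, and what remains must come from
`X`. -/
theorem mem_rowSpan_insertRow {w : ι → A} : w ∈ rowSpan (insertRow k c X v) ↔
    (fun l : {l : ι // l ≠ c} => w l.1 - w c * v l) ∈ rowSpan X := by
  rw [mem_rowSpan, mem_rowSpan]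
  constructor
  · rintro ⟨u, rfl⟩
    refine ⟨fun a => u (k.succAbove a), ?_⟩
    ext l
    simp [vecMul_apply, Fin.sum_univ_succAbove _ k]
  · rintro ⟨u, hu⟩
    refine ⟨k.insertNth (w c) u, ?_⟩
    ext l
    by_cases hl : l = c
    · subst hl
      simp [vecMul_apply, Fin.sum_univ_succAbove _ k]
    · lift l to {l : ι // l ≠ c} using hl
      have := congrFun hu l
      simp only [vecMul_apply] at this
      simp [vecMul_apply, Fin.sum_univ_succAbove _ k, ← this]

/-- The span depends only on the smaller space and on `v` modulo it. This matches the two echelon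
bases built over a given point, with x = v and y = v + uX. -/
theorem rowSpan_insertRow_eq {k' : Fin (d + 1)} {Y : Matrix (Fin d) {l : ι // l ≠ c} A}
    (h : rowSpan X = rowSpan Y) (u : Fin d → A) :
    rowSpan (insertRow k c X v) = rowSpan (insertRow k' c Y (v + Matrix.vecMul u X)) := by
  ext w
  rw [mem_rowSpan_insertRow, mem_rowSpan_insertRow, ← h]
  have hu : Matrix.vecMul u X ∈ rowSpan X := mem_rowSpan.2 ⟨u, rfl⟩
  rw [← Submodule.sub_mem_iff_left _ (Submodule.smul_mem _ (w c) hu)]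
  refine iff_of_eq (congrArg (· ∈ _) ?_)
  ext l
  simp only [Pi.sub_apply, Pi.smul_apply, Pi.add_apply, smul_eq_mul]
  ring

end Deletion

/-! ### Echelon forms under deletion and insertion of a pivot -/

section EchelonDeletion

variable {A : Type u} [CommRing A] {ι α : Type} [LinearOrder ι] [LinearOrder α] {d : ℕ}
  {T : ι → α} {i : Fin (d + 1) ↪o ι} {k : Fin (d + 1)} {c : ι}

theorem IsEchelon.submatrix_succAbove {β : Type} [LinearOrder β] {S : {l : ι // l ≠ c} → β}
    (hS : ∀ l m, S l < S m → T l.1 < T m.1) {X : Matrix (Fin (d + 1)) ι A} (hX : IsEchelon T i X)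
    (hi : i k = c) :
    IsEchelon S (removeElem i k c hi) (X.submatrix k.succAbove Subtype.val) where
  pivot := by
    ext a b
    change X (k.succAbove a) (i (k.succAbove b)) = _
    rw [hX.apply_pivot, Matrix.one_apply]
    simp
  vanish a l hl := hX.vanish _ _ (hS _ _ hl)

theorem IsEchelon.apply_col {X : Matrix (Fin (d + 1)) ι A} (hX : IsEchelon T i X)
    (hi : i k = c) (a : Fin (d + 1)) : X a c = if a = k then 1 else 0 := by
  rw [← hi, hX.apply_pivot]

theorem IsEchelon.insertRow {X : Matrix (Fin d) {l : ι // l ≠ c} A} {hi : i k = c}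
    (hX : IsEchelon (T ∘ Subtype.val) (removeElem i k c hi) X) {v : {l : ι // l ≠ c} → A}
    (hv : ∀ a, v (removeElem i k c hi a) = 0) (hv' : ∀ l, T c < T l.1 → v l = 0) :
    IsEchelon T i (insertRow k c X v) where
  pivot := by
    ext a b
    rw [Matrix.submatrix_apply, id, Matrix.one_apply]
    induction b using k.succAboveCases with
    | x => rw [hi, insertRow_apply_col]
    | p b =>
      have hb : i (k.succAbove b) = (removeElem i k c hi b).1 := rfl
      induction a using k.succAboveCases with
      | x => rw [hb, insertRow_same, insertCoord_val, hv, if_neg (k.succAbove_ne b).symm]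
      | p a =>
        rw [hb, insertRow_succAbove, insertCoord_val, hX.apply_pivot]
        simp
  vanish a l hl := by
    by_cases hlc : l = c
    · subst hlc
      rw [insertRow_apply_col, if_neg]
      rintro rfl
      rw [hi] at hl
      exact lt_irrefl _ hl
    · lift l to {l : ι // l ≠ c} using hlc
      induction a using k.succAboveCases with
      | x => rw [insertRow_same, insertCoord_val, hv' l (hi ▸ hl)]
      | p a => rw [insertRow_succAbove, insertCoord_val, hX.vanish a l hl]

end EchelonDeletion

/-! ### The fibres of the deletion map -/

section Fibre

variable {A : Type u} [CommRing A] {ι : Type} [LinearOrder ι] {d : ℕ}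

/-- The fibre of the deletion map over a point with base change matrix `M`. -/
def fibre (k k' : Fin (d + 1)) (M : Matrix (Fin d) (Fin d) A) : Submodule A (Fin d → A) where
  -- After renumbering, `k ≤ a.castSucc` means that the a-th element of I' exceeds c, and
  -- `b.castSucc < k'` that the b-th element of J' lies below c.
  carrier := {u | (∀ a, k ≤ a.castSucc → u a = 0) ∧
    ∀ b, b.castSucc < k' → Matrix.vecMul u M b = 0}
  add_mem' {u v} hu hv := ⟨fun a ha => by simp [hu.1 a ha, hv.1 a ha],
    fun b hb => by simp [Matrix.add_vecMul, hu.2 b hb, hv.2 b hb]⟩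
  zero_mem' := by simp
  smul_mem' t u hu := ⟨fun a ha => by simp [hu.1 a ha],
    fun b hb => by simp [Matrix.smul_vecMul, hu.2 b hb]⟩

variable {i j : Fin (d + 1) ↪o ι} {k k' : Fin (d + 1)} {c : ι}
  {X Y : Matrix (Fin (d + 1)) ι A}

/-- This is y = x + uX': the pivot columns I give the coefficients of y in the basis X, and the
coefficient of x is y_c = 1. -/
theorem apply_eq_add_vecMul (hX : IsEchelon OrderDual.toDual i X) (hY : IsEchelon id j Y)
    (h : rowSpan X = rowSpan Y) (hi : i k = c) (hj : j k' = c) (l : ι) :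
    Y k' l = X k l + Matrix.vecMul (fun a => Y k' (i (k.succAbove a)))
      (X.submatrix k.succAbove id) l := by
  have hYX := congrFun (congrFun (eq_mul_of_rowSpan_le h.ge hX.pivot) k') l
  rw [hYX, Matrix.mul_apply, Fin.sum_univ_succAbove _ k, Matrix.submatrix_apply, hi, id,
    hY.apply_col hj, if_pos rfl, one_mul]
  rfl

/-- The first condition holds because y vanishes right of c; the second because, at elements of J
left of c, both x and y vanish. -/
theorem mem_fibre (hX : IsEchelon OrderDual.toDual i X) (hY : IsEchelon id j Y)
    (h : rowSpan X = rowSpan Y) (hi : i k = c) (hj : j k' = c) :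
    (fun a => Y k' (i (k.succAbove a))) ∈
      fibre k k' ((X.submatrix id j).submatrix k.succAbove k'.succAbove) := by
  refine ⟨fun a ha => ?_, fun b hb => ?_⟩
  · refine hY.vanish _ _ ?_
    rw [id, id, hj, ← hi, i.lt_iff_lt]
    exact Fin.lt_succAbove_iff_le_castSucc _ _ |>.2 ha
  · have hlt : j (k'.succAbove b) < c := by
      rw [← hj, j.lt_iff_lt]
      exact Fin.succAbove_lt_iff_castSucc_lt _ _ |>.2 hb
    have := apply_eq_add_vecMul hX hY h hi hj (j (k'.succAbove b))
    rw [hY.apply_pivot, if_neg (k'.succAbove_ne b).symm,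
      hX.vanish k _ (by rw [hi]; exact hlt), zero_add] at this
    exact this.symm

/-- Left of c the row x is zero; right of c the row y is zero, so x = -uX' there. Thus X' and u
determine X. -/
theorem eq_of_fibre_coord_eq {X' Y' : Matrix (Fin (d + 1)) ι A}
    (hX : IsEchelon OrderDual.toDual i X) (hY : IsEchelon id j Y) (h : rowSpan X = rowSpan Y)
    (hX' : IsEchelon OrderDual.toDual i X') (hY' : IsEchelon id j Y')
    (h' : rowSpan X' = rowSpan Y') (hi : i k = c) (hj : j k' = c)
    (hXX : X.submatrix k.succAbove (Subtype.val : {l : ι // l ≠ c} → ι) =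
      X'.submatrix k.succAbove Subtype.val)
    (hu : ∀ a, Y k' (i (k.succAbove a)) = Y' k' (i (k.succAbove a))) : X = X' := by
  rw [eq_insertRow (hX.apply_col hi), eq_insertRow (hX'.apply_col hi), hXX]
  congr 1
  ext l
  rcases lt_or_gt_of_ne l.2 with hl | hl
  · rw [hX.vanish k _ (by rw [hi]; exact hl), hX'.vanish k _ (by rw [hi]; exact hl)]
  · have e := apply_eq_add_vecMul hX hY h hi hj l.1
    have e' := apply_eq_add_vecMul hX' hY' h' hi hj l.1
    rw [hY.vanish k' _ (by rw [hj]; exact hl)] at e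
    rw [hY'.vanish k' _ (by rw [hj]; exact hl)] at e'
    have hs : Matrix.vecMul (fun a => Y k' (i (k.succAbove a))) (X.submatrix k.succAbove id) l.1 =
        Matrix.vecMul (fun a => Y' k' (i (k.succAbove a))) (X'.submatrix k.succAbove id) l.1 := by
      rw [vecMul_apply, vecMul_apply]
      refine Finset.sum_congr rfl fun a _ => ?_
      rw [hu a]
      exact congrArg _ (congrFun (congrFun hXX a) l)
    rw [← hs] at e'
    exact add_right_cancel (e.symm.trans e')

theorem exists_of_mem_fibre {X Y : Matrix (Fin d) {l : ι // l ≠ c} A} (hi : i k = c) (hj : j k' = c)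
    (hX : IsEchelon OrderDual.toDual (removeElem i k c hi) X)
    (hY : IsEchelon id (removeElem j k' c hj) Y) (h : rowSpan X = rowSpan Y)
    {u : Fin d → A} (hu : u ∈ fibre k k' (X.submatrix id (removeElem j k' c hj))) :
    ∃ X₁ Y₁ : Matrix (Fin (d + 1)) ι A, IsEchelon OrderDual.toDual i X₁ ∧ IsEchelon id j Y₁ ∧
      rowSpan X₁ = rowSpan Y₁ ∧ X₁.submatrix k.succAbove Subtype.val = X ∧
      ∀ a, Y₁ k' (i (k.succAbove a)) = u a := by
  have hlt : ∀ (f : Fin (d + 1) ↪o ι) (m : Fin (d + 1)) (hf : f m = c) (a : Fin d),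
      (removeElem f m c hf a).1 < c ↔ a.castSucc < m := fun f m hf a => by
    rw [← Fin.succAbove_lt_iff_castSucc_lt, ← f.lt_iff_lt, hf]
    rfl
  have huX : ∀ a, Matrix.vecMul u X (removeElem i k c hi a) = u a := fun a => by
    simp [vecMul_apply, hX.apply_pivot]
  -- Cut uX at c: the right part, negated, is x, and the left part is y = x + uX.
  let v : {l : ι // l ≠ c} → A := fun l => if l.1 < c then 0 else - Matrix.vecMul u X l
  have hvu : ∀ l, (v + Matrix.vecMul u X) l = if l.1 < c then Matrix.vecMul u X l else 0 := by
    intro l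
    simp only [v, Pi.add_apply]
    split_ifs <;> simp
  refine ⟨insertRow k c X v, insertRow k' c Y (v + Matrix.vecMul u X), ?_, ?_,
    rowSpan_insertRow_eq h u, insertRow_submatrix, fun a => ?_⟩
  · refine IsEchelon.insertRow (hi := hi) ⟨hX.pivot, fun a l hl => hX.vanish a l hl⟩
      (fun a => ?_) fun l hl => if_pos hl
    by_cases ha : (removeElem i k c hi a).1 < c
    · exact if_pos ha
    · simp only [v]
      rw [if_neg ha, huX, hu.1 a (not_lt.1 fun e => ha ((hlt _ _ _ _).2 e)), neg_zero]
  · refine IsEchelon.insertRow (hi := hj) ⟨hY.pivot, fun a l hl => hY.vanish a l hl⟩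
      (fun b => ?_) fun l hl => ?_
    · rw [hvu]
      split_ifs with hb
      · exact hu.2 b ((hlt _ _ _ _).1 hb)
      · rfl
    · rw [hvu]
      exact if_neg (not_lt_of_gt hl)
  · have ha : i (k.succAbove a) = (removeElem i k c hi a).1 := rfl
    rw [insertRow_same, ha, insertCoord_val, hvu]
    split_ifs with hlc
    · exact huX a
    · exact (hu.1 a (not_lt.1 fun e => hlc ((hlt _ _ _ _).2 e))).symm

end Fibre

/-! ### Linear coordinates on the fibres -/

section Charts

variable {A B : Type u} [CommRing A] [CommRing B] {d r : ℕ} {k k' : Fin (d + 1)}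

/-- The index set of the equations that cut out a fibre, together with `r` coordinates. -/
abbrev ChartIndex (k k' : Fin (d + 1)) (r : ℕ) : Type :=
  ({b : Fin d // b.castSucc < k'} ⊕ {a : Fin d // k ≤ a.castSucc}) ⊕ Fin r

/-- The columns of this matrix are the equations of the fibre over a point with base change matrix
`M` and the coordinates `u ↦ u (e s)`. -/
def chartMatrix (k k' : Fin (d + 1)) (M : Matrix (Fin d) (Fin d) A) (e : Fin r → Fin d) :
    Matrix (Fin d) (ChartIndex k k' r) A :=
  Matrix.of fun a => Sum.elim (Sum.elim (fun b => M a b.1) fun a' => if a = a'.1 then 1 else 0)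
    fun s => if a = e s then 1 else 0

theorem chartMatrix_map (φ : A →+* B) (M : Matrix (Fin d) (Fin d) A) (e : Fin r → Fin d) :
    (chartMatrix k k' M e).map φ = chartMatrix k k' (M.map φ) e := by
  ext a x
  rcases x with (b | a') | s <;> simp [chartMatrix, apply_ite φ]

theorem vecMul_chartMatrix (M : Matrix (Fin d) (Fin d) A) (e : Fin r → Fin d) (u : Fin d → A) :
    Matrix.vecMul u (chartMatrix k k' M e) =
      Sum.elim (Sum.elim (fun b => Matrix.vecMul u M b.1) fun a => u a.1) fun s => u (e s) := by
  ext x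
  rcases x with (b | a') | s <;> simp [chartMatrix, vecMul_apply]

/-- The determinant whose non-vanishing locus is the domain of a chart. -/
def chartDet (k k' : Fin (d + 1)) (e : Fin r → Fin d) (σ : Fin d ≃ ChartIndex k k' r)
    (M : Matrix (Fin d) (Fin d) A) : A :=
  ((chartMatrix k k' M e).submatrix id σ).det

theorem chartDet_map (φ : A →+* B) (e : Fin r → Fin d) (σ : Fin d ≃ ChartIndex k k' r)
    (M : Matrix (Fin d) (Fin d) A) : chartDet k k' e σ (M.map φ) = φ (chartDet k k' e σ M) := by
  rw [chartDet, chartDet, RingHom.map_det, ← chartMatrix_map]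
  rfl

/-- The coordinates `u ↦ u (e s)` on a fibre. -/
def fibreCoord (k k' : Fin (d + 1)) (M : Matrix (Fin d) (Fin d) A) (e : Fin r → Fin d) :
    fibre k k' M →ₗ[A] (Fin r → A) :=
  (LinearMap.funLeft A A e).comp (fibre k k' M).subtype

/-- For the invertible chart matrix C, the fibre consists of those u for which the equation entries
of uC vanish; the remaining entries are free and are the coordinates. -/
theorem fibreCoord_bijective {M : Matrix (Fin d) (Fin d) A} {e : Fin r → Fin d}
    {σ : Fin d ≃ ChartIndex k k' r} (h : IsUnit (chartDet k k' e σ M)) :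
    Function.Bijective (fibreCoord k k' M e) := by
  set C := (chartMatrix k k' M e).submatrix id σ with hC
  have hCu : IsUnit C := (Matrix.isUnit_iff_isUnit_det C).2 h
  have hvec : ∀ u, Matrix.vecMul u C = Matrix.vecMul u (chartMatrix k k' M e) ∘ σ := fun u => rfl
  constructor
  · intro u v huv
    refine Subtype.ext (Matrix.vecMul_injective_of_isUnit hCu ?_)
    change Matrix.vecMul u.1 C = Matrix.vecMul v.1 C
    rw [hvec, hvec, vecMul_chartMatrix, vecMul_chartMatrix]
    congr 2
    · congr 1
      · ext b
        rw [u.2.2 b.1 b.2, v.2.2 b.1 b.2]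
      · ext a
        rw [u.2.1 a.1 a.2, v.2.1 a.1 a.2]
  · intro v
    let t : ChartIndex k k' r → A := Sum.elim 0 v
    let u : Fin d → A := Matrix.vecMul (t ∘ σ) C⁻¹
    have hu : Matrix.vecMul u (chartMatrix k k' M e) = t := by
      apply σ.surjective.injective_comp_right
      change Matrix.vecMul u (chartMatrix k k' M e) ∘ σ = t ∘ σ
      rw [← hvec, Matrix.vecMul_vecMul, Matrix.nonsing_inv_mul _ h, Matrix.vecMul_one]
    rw [vecMul_chartMatrix] at hu
    refine ⟨⟨u, fun a ha => congrFun hu (.inl (.inr ⟨a, ha⟩)),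
      fun b hb => congrFun hu (.inl (.inl ⟨b, hb⟩))⟩, ?_⟩
    ext s
    exact congrFun hu (.inr s)

theorem exists_fibreCoord_transition {M : Matrix (Fin d) (Fin d) A} {e e' : Fin r → Fin d}
    (he : Function.Bijective (fibreCoord k k' M e))
    (he' : Function.Bijective (fibreCoord k k' M e')) :
    ∃ g : GL (Fin r) A, ∀ u, fibreCoord k k' M e' u = g.val.mulVec (fibreCoord k k' M e u) := by
  let f := (LinearEquiv.ofBijective _ he).symm.trans (LinearEquiv.ofBijective _ he')
  refine ⟨⟨LinearMap.toMatrix' f, LinearMap.toMatrix' f.symm, ?_, ?_⟩, fun u => ?_⟩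
  · rw [← LinearMap.toMatrix'_comp, LinearEquiv.comp_symm, LinearMap.toMatrix'_id]
  · rw [← LinearMap.toMatrix'_comp, LinearEquiv.symm_comp, LinearMap.toMatrix'_id]
  · change _ = (LinearMap.toMatrix' f.toLinearMap).mulVec _
    rw [LinearMap.toMatrix'_mulVec]
    change _ = LinearEquiv.ofBijective _ he' ((LinearEquiv.ofBijective _ he).symm _)
    rw [← LinearEquiv.ofBijective_apply _ (hf := he) u, LinearEquiv.symm_apply_apply]
    rfl

end Charts

/-! ### Independence of the fibre equations over a field -/

section Cover

variable {K : Type u} [Field K] {d : ℕ} {k k' : Fin (d + 1)}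

/-- If the equations of a fibre over a field are independent, the fibre has a chart. -/
theorem exists_isUnit_chartDet {M L : Matrix (Fin d) (Fin d) K} (hLM : L * M = 1)
    (hL : ∀ b a, b.castSucc < k' → k ≤ a.castSucc → L b a = 0) :
    ∃ (e : Fin (k - k') → Fin d) (σ : Fin d ≃ ChartIndex k k' (k - k')),
      IsUnit (chartDet k k' e σ M) := by
  classical
  -- All candidate columns of a chart matrix: columns of `M` and standard basis vectors. The map `f`
  -- below picks those that are fibre equations.
  let v : Fin d ⊕ Fin d → Fin d → K := Sum.elim M.col fun a => Pi.single a 1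
  let f : {b : Fin d // b.castSucc < k'} ⊕ {a : Fin d // k ≤ a.castSucc} → Fin d ⊕ Fin d :=
    Sum.map Subtype.val Subtype.val
  have hf : Function.Injective f := Subtype.val_injective.sumMap Subtype.val_injective
  have hfv : LinearIndependent K (v ∘ f) := by
    rw [Fintype.linearIndependent_iff]
    intro g hg
    have hl : ∀ b, g (.inl b) = 0 := by
      intro b
      -- Row b of `L` is dual to the columns of `M` and orthogonal to the standard vectors among the
      -- equations, so it isolates the coefficient of column b.
      have h0 : L b.1 ⬝ᵥ ∑ x, g x • (v ∘ f) x = 0 := by rw [hg, dotProduct_zero]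
      have hM : ∀ b' : {b : Fin d // b.castSucc < k'},
          L b.1 ⬝ᵥ M.col b'.1 = if b = b' then 1 else 0 := fun b' => by
        change (L * M) b.1 b'.1 = _
        rw [hLM, Matrix.one_apply]
        simp only [Subtype.ext_iff]
      have hL' : ∀ a : {a : Fin d // k ≤ a.castSucc},
          L b.1 ⬝ᵥ Pi.single a.1 (1 : K) = 0 := fun a => by
        rw [dotProduct_single, hL b.1 a.1 b.2 a.2, zero_mul]
      rw [dotProduct_sum] at h0
      simpa [dotProduct_smul, v, f, hM, hL'] using h0
    rintro (b | a)
    · exact hl b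
    · have h0 := congrFun hg a.1
      simp only [Fintype.sum_sum_type, hl, zero_smul, Finset.sum_const_zero, zero_add,
        Finset.sum_apply, Pi.smul_apply, Pi.zero_apply] at h0
      have hv : ∀ a', (v ∘ f) (.inr a') a.1 = if a = a' then 1 else 0 := fun a' => by
        simp [v, f, Pi.single_apply, Subtype.ext_iff]
      simpa [hv] using h0
  have hfr : LinearIndepOn K v (Set.range f) := (linearIndepOn_range_iff hf v).2 hfv
  -- The equations are completed to a basis by standard vectors only, so the added functionals are
  -- coordinates u ↦ u_a.
  obtain ⟨s, hst, hfs, hspan, hs⟩ :=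
    exists_linearIndepOn_extension hfr (Set.subset_union_left (t := Set.range Sum.inr))
  let b : Module.Basis s K (Fin d → K) := Module.Basis.mk hs (by
    rw [← (Pi.basisFun K (Fin d)).span_eq, Submodule.span_le]
    rintro _ ⟨a, rfl⟩
    rw [← Set.image_eq_range]
    exact hspan ⟨.inr a, .inr ⟨a, rfl⟩, by simp [v]⟩)
  have hsc : Fintype.card s = d := by
    rw [← Module.finrank_eq_card_basis b, Module.finrank_fin_fun]
  let β : Fin d ≃ s := (Fintype.equivFinOfCardEq hsc).symm
  have hcard : ∀ m : Fin (d + 1), Fintype.card {b : Fin d // b.castSucc < m} = m := fun m => by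
    simp only [Fin.lt_def, Fin.val_castSucc]
    rw [Fintype.card_subtype, Fin.card_filter_val_lt, min_eq_right m.is_le]
  have hc1 : Fintype.card {b : Fin d // b.castSucc < k'} = k' := hcard k'
  have hc2 : Fintype.card {a : Fin d // k ≤ a.castSucc} = d - k := by
    have h := Fintype.card_subtype_compl fun a : Fin d => a.castSucc < k
    rw [hcard, Fintype.card_fin] at h
    simpa only [not_lt] using h
  have hcf : Fintype.card (Set.range f) = k' + (d - k) := by
    rw [← Fintype.card_congr (Equiv.ofInjective f hf), Fintype.card_sum, hc1, hc2]
  -- Independence already forces k' + (d - k) ≤ d, hence k' ≤ k, so the subtraction is not truncated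
  -- here.
  have hcd : Fintype.card ↥(s \ Set.range f) = k - k' := by
    have := Fintype.card_congr (Equiv.Set.sumDiffSubset hfs)
    rw [Fintype.card_sum, hcf, hsc] at this
    have := k.is_le
    omega
  let ε : Fin (k - k') ≃ ↥(s \ Set.range f) := (Fintype.equivFinOfCardEq hcd).symm
  have he : ∀ x, ∃ a, (.inr a : Fin d ⊕ Fin d) = (ε x).1 := fun x =>
    (hst (ε x).2.1).resolve_left (ε x).2.2
  choose e he using he
  let τ : ChartIndex k k' (k - k') ≃ s :=
    (Equiv.sumCongr (Equiv.ofInjective f hf) ε).trans (Equiv.Set.sumDiffSubset hfs)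
  have hτ : ∀ x, (chartMatrix k k' M e).col x = v (τ x) := by
    rintro (x | x)
    · have : (τ (.inl x)).1 = f x := rfl
      rw [this]
      rcases x with x | x
      · rfl
      · ext a
        simp [chartMatrix, v, f, Pi.single_apply]
    · have : (τ (.inr x)).1 = (ε x).1 := rfl
      rw [this, ← he]
      ext a
      simp [chartMatrix, v, Pi.single_apply]
  refine ⟨e, β.trans τ.symm, ?_⟩
  rw [chartDet, ← Matrix.isUnit_iff_isUnit_det, ← Matrix.linearIndependent_cols_iff_isUnit]
  have hcol : ((chartMatrix k k' M e).submatrix id (β.trans τ.symm)).col = (fun x : s => v x) ∘ β := by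
    ext1 x
    change (chartMatrix k k' M e).col (τ.symm (β x)) = v (β x)
    rw [hτ, Equiv.apply_symm_apply]
  rw [hcol]
  exact hs.comp β β.injective

end Cover

/-! ### The deletion morphism -/

section Deletion

variable {F : Type u} [Field F] {ι : Type} [Fintype ι] [LinearOrder ι] {d : ℕ}

section EchelonForms

variable {i j : Fin d ↪o ι} {A B : CommAlgCat.{u} F}

theorem exists_negEchelon (W : (richardson F i j).obj A) :
    ∃ X : Matrix (Fin d) ι A, IsEchelon OrderDual.toDual i X ∧ rowSpan X = W.1 :=
  mem_negCellPoints.1 W.2.1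

theorem exists_posEchelon (W : (richardson F i j).obj A) :
    ∃ Y : Matrix (Fin d) ι A, IsEchelon id j Y ∧ rowSpan Y = W.1 :=
  mem_posCellPoints.1 W.2.2

/-- The echelon form of a point of `R_{I,J}` with pivots `I`. -/
noncomputable def negEchelon (W : (richardson F i j).obj A) : Matrix (Fin d) ι A :=
  (exists_negEchelon W).choose

/-- The echelon form of a point of `R_{I,J}` with pivots `J`. -/
noncomputable def posEchelon (W : (richardson F i j).obj A) : Matrix (Fin d) ι A :=
  (exists_posEchelon W).choose

theorem isEchelon_negEchelon (W : (richardson F i j).obj A) :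
    IsEchelon OrderDual.toDual i (negEchelon W) := (exists_negEchelon W).choose_spec.1

theorem isEchelon_posEchelon (W : (richardson F i j).obj A) :
    IsEchelon id j (posEchelon W) := (exists_posEchelon W).choose_spec.1

theorem rowSpan_negEchelon (W : (richardson F i j).obj A) : rowSpan (negEchelon W) = W.1 :=
  (exists_negEchelon W).choose_spec.2

theorem rowSpan_posEchelon (W : (richardson F i j).obj A) : rowSpan (posEchelon W) = W.1 :=
  (exists_posEchelon W).choose_spec.2

theorem rowSpan_negEchelon_eq (W : (richardson F i j).obj A) :
    rowSpan (negEchelon W) = rowSpan (posEchelon W) :=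
  (rowSpan_negEchelon W).trans (rowSpan_posEchelon W).symm

theorem negEchelon_eq {W : (richardson F i j).obj A} {X : Matrix (Fin d) ι A}
    (hX : IsEchelon OrderDual.toDual i X) (h : rowSpan X = W.1) : negEchelon W = X :=
  (isEchelon_negEchelon W).eq_of_rowSpan_eq hX ((rowSpan_negEchelon W).trans h.symm)

theorem posEchelon_eq {W : (richardson F i j).obj A} {Y : Matrix (Fin d) ι A}
    (hY : IsEchelon id j Y) (h : rowSpan Y = W.1) : posEchelon W = Y :=
  (isEchelon_posEchelon W).eq_of_rowSpan_eq hY ((rowSpan_posEchelon W).trans h.symm)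

theorem negEchelon_map (f : A ⟶ B) (W : (richardson F i j).obj A) :
    negEchelon ((richardson F i j).map f W) = (negEchelon W).map f.hom.toRingHom := by
  refine negEchelon_eq ((isEchelon_negEchelon W).map _) ?_
  rw [← extendScalars_rowSpan, rowSpan_negEchelon]
  rfl

theorem posEchelon_map (f : A ⟶ B) (W : (richardson F i j).obj A) :
    posEchelon ((richardson F i j).map f W) = (posEchelon W).map f.hom.toRingHom := by
  refine posEchelon_eq ((isEchelon_posEchelon W).map _) ?_
  rw [← extendScalars_rowSpan, rowSpan_posEchelon]
  rfl

/-- The base change matrix of a point of `R_{I,J}`. -/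
noncomputable def baseChange (W : (richardson F i j).obj A) : Matrix (Fin d) (Fin d) A :=
  (negEchelon W).submatrix id j

theorem baseChange_map (f : A ⟶ B) (W : (richardson F i j).obj A) :
    baseChange ((richardson F i j).map f W) = (baseChange W).map f.hom.toRingHom := by
  rw [baseChange, negEchelon_map]
  rfl

/-- Any representative has the same base change matrix, and for the echelon form the block at I is
the identity. -/
theorem mem_stratum {w : Equiv.Perm (Fin d)} {W : (richardson F i j).obj A} :
    W ∈ (stratum F i j w).obj A ↔ baseChange W ∈ bruhatPoints A w := by
  have hp := (isEchelon_negEchelon W).pivot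
  have hu : IsUnit ((negEchelon W).submatrix id i) := by rw [hp]; exact isUnit_one
  have hb : baseChangeMatrix i j (negEchelon W) = baseChange W := by
    rw [baseChangeMatrix, hp, inv_one, Matrix.one_mul, baseChange]
  constructor
  · rintro ⟨X, hX, hXu, hw⟩
    rwa [(baseChangeMatrix_congr i j X (negEchelon W)
      (hX.trans (rowSpan_negEchelon W).symm) hXu).2, hb] at hw
  · intro h
    exact ⟨negEchelon W, rowSpan_negEchelon W, hu, by rwa [hb]⟩

end EchelonForms

variable {i j : Fin (d + 1) ↪o ι} {k k' : Fin (d + 1)} {c : ι} {A B : CommAlgCat.{u} F}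

theorem deleteCoord_eq_neg (hi : i k = c) (W : (richardson F i j).obj A) :
    rowSpan ((negEchelon W).submatrix k.succAbove Subtype.val) = deleteCoord c W.1 := by
  rw [← rowSpan_negEchelon W, deleteCoord_rowSpan ((isEchelon_negEchelon W).apply_col hi)]

theorem deleteCoord_eq_pos (hj : j k' = c) (W : (richardson F i j).obj A) :
    rowSpan ((posEchelon W).submatrix k'.succAbove Subtype.val) = deleteCoord c W.1 := by
  rw [← rowSpan_posEchelon W, deleteCoord_rowSpan ((isEchelon_posEchelon W).apply_col hj)]

/-- The morphism `R_{I,J} → R_{I',J'}` that intersects a subspace with the hyperplane `v c = 0`. -/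
def deletion (F : Type u) [Field F] (hi : i k = c) (hj : j k' = c) :
    richardson F i j ⟶ richardson F (removeElem i k c hi) (removeElem j k' c hj) where
  app A := ↾fun W => ⟨deleteCoord c W.1,
    mem_negCellPoints.2 ⟨_, (isEchelon_negEchelon W).submatrix_succAbove (S := OrderDual.toDual)
      (fun _ _ h => h) hi,
      deleteCoord_eq_neg hi W⟩,
    mem_posCellPoints.2 ⟨_, (isEchelon_posEchelon W).submatrix_succAbove (S := id) (fun _ _ h => h) hj,
      deleteCoord_eq_pos hj W⟩⟩
  naturality A B f := by
    refine ConcreteCategory.hom_ext _ _ fun W => Subtype.ext ?_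
    change deleteCoord c ((richardson F i j).map f W).1 =
      extendScalars f.hom.toRingHom (deleteCoord c W.1)
    rw [← deleteCoord_eq_neg hi, ← deleteCoord_eq_neg hi, extendScalars_rowSpan, negEchelon_map]
    rfl

theorem negEchelon_deletion (hi : i k = c) (hj : j k' = c) (W : (richardson F i j).obj A) :
    negEchelon ((deletion F hi hj).app A W) =
      (negEchelon W).submatrix k.succAbove Subtype.val :=
  negEchelon_eq
    ((isEchelon_negEchelon W).submatrix_succAbove (S := OrderDual.toDual) (fun _ _ h => h) hi)
    (deleteCoord_eq_neg hi W)

theorem baseChange_deletion (hi : i k = c) (hj : j k' = c) (W : (richardson F i j).obj A) :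
    baseChange ((deletion F hi hj).app A W) =
      (baseChange W).submatrix k.succAbove k'.succAbove := by
  rw [baseChange, negEchelon_deletion]
  rfl

/-- Column c of the echelon form is a standard vector, and its row k vanishes left of c = j_{k'}:
these are the hypotheses of the two double coset lemmas. -/
theorem preimage_stratum (hi : i k = c) (hj : j k' = c) {w : Equiv.Perm (Fin (d + 1))}
    (hw : w k' = k) :
    (stratum F (removeElem i k c hi) (removeElem j k' c hj) (restrictPerm w k')).preimage
      (deletion F hi hj) = stratum F i j w := by
  ext A W
  change (deletion F hi hj).app A W ∈ (stratum F _ _ _).obj A ↔ _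
  rw [mem_stratum, mem_stratum, baseChange_deletion]
  have hX := isEchelon_negEchelon W
  have hcol : ∀ a, baseChange W a k' = if a = k then 1 else 0 := fun a => by
    rw [baseChange, Matrix.submatrix_apply, hj, id, hX.apply_col hi]
  have hcol' : ∀ a, baseChange W (k.succAbove a) k' = 0 := fun a => by
    rw [hcol, if_neg (k.succAbove_ne a)]
  refine ⟨bruhatPoints_of_submatrix hw hcol' (by rw [hcol, if_pos rfl]) fun b hb => ?_,
    bruhatPoints_submatrix hw hcol'⟩
  refine hX.vanish k (j b) ?_
  change j b < i k
  rw [hi, ← hj]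
  exact j.strictMono hb

/-! ### The charts -/

/-- The fibre coordinates of a point of `R_{I,J}`. -/
noncomputable def toFibre (hi : i k = c) (hj : j k' = c) (W : (richardson F i j).obj A) :
    fibre k k' (baseChange ((deletion F hi hj).app A W)) :=
  ⟨fun a => posEchelon W k' (i (k.succAbove a)), by
    rw [baseChange_deletion]
    exact mem_fibre (isEchelon_negEchelon W) (isEchelon_posEchelon W) (rowSpan_negEchelon_eq W)
      hi hj⟩

theorem eq_of_deletion_eq (hi : i k = c) (hj : j k' = c) {V W : (richardson F i j).obj A}
    (h : (deletion F hi hj).app A V = (deletion F hi hj).app A W)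
    (hu : (toFibre hi hj V).1 = (toFibre hi hj W).1) : V = W := by
  refine Subtype.ext ?_
  rw [← rowSpan_negEchelon V, ← rowSpan_negEchelon W]
  congr 1
  refine eq_of_fibre_coord_eq (isEchelon_negEchelon V) (isEchelon_posEchelon V)
    (rowSpan_negEchelon_eq V) (isEchelon_negEchelon W) (isEchelon_posEchelon W)
    (rowSpan_negEchelon_eq W) hi hj ?_ (congrFun hu)
  rw [← negEchelon_deletion hi hj, ← negEchelon_deletion hi hj, h]

theorem exists_deletion_eq (hi : i k = c) (hj : j k' = c)
    (V : (richardson F (removeElem i k c hi) (removeElem j k' c hj)).obj A) {u : Fin d → A}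
    (hu : u ∈ fibre k k' (baseChange V)) : ∃ W : (richardson F i j).obj A,
      (deletion F hi hj).app A W = V ∧ (toFibre hi hj W).1 = u := by
  obtain ⟨X, Y, hX, hY, hXY, hXV, hYu⟩ := exists_of_mem_fibre hi hj (isEchelon_negEchelon V)
    (isEchelon_posEchelon V) (rowSpan_negEchelon_eq V) hu
  let W : (richardson F i j).obj A :=
    ⟨rowSpan X, mem_negCellPoints.2 ⟨X, hX, rfl⟩, mem_posCellPoints.2 ⟨Y, hY, hXY.symm⟩⟩
  refine ⟨W, Subtype.ext ?_, ?_⟩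
  · change deleteCoord c (rowSpan X) = V.1
    rw [deleteCoord_rowSpan (hX.apply_col hi), hXV, rowSpan_negEchelon]
  · ext a
    change posEchelon W k' _ = _
    rw [posEchelon_eq hY (W := W) hXY.symm, hYu]

/-- The domain of a chart. -/
def chartBase (F : Type u) [Field F] (hi : i k = c) (hj : j k' = c) {r : ℕ} (e : Fin r → Fin d)
    (σ : Fin d ≃ ChartIndex k k' r) :
    Subfunctor (richardson F (removeElem i k c hi) (removeElem j k' c hj)) where
  obj A := {V | IsUnit (chartDet k k' e σ (baseChange V))}
  map f V hV := by
    change IsUnit _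
    rw [baseChange_map, chartDet_map]
    exact RingHom.isUnit_map _ hV

theorem isOpenSubfunctor_chartBase (hi : i k = c) (hj : j k' = c) {r : ℕ} (e : Fin r → Fin d)
    (σ : Fin d ≃ ChartIndex k k' r) : IsOpenSubfunctor (chartBase F hi hj e σ) := by
  intro A V
  refine ⟨Ideal.span {chartDet k k' e σ (baseChange V)}, fun B f => ?_⟩
  rw [Ideal.map_span, Set.image_singleton, Ideal.span_singleton_eq_top, ← chartDet_map,
    ← baseChange_map]
  rfl

/-- The trivialization of the deletion morphism over the domain of a chart. -/
noncomputable def chart (F : Type u) [Field F] (hi : i k = c) (hj : j k' = c) {r : ℕ}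
    (e : Fin r → Fin d) (σ : Fin d ≃ ChartIndex k k' r) :
    LocalTrivialization (deletion F hi hj) r where
  base := chartBase F hi hj e σ
  isOpen := isOpenSubfunctor_chartBase hi hj e σ
  coord := {
    app A := ↾fun W s => posEchelon W.1 k' (i (k.succAbove (e s)))
    naturality A B f := by
      refine ConcreteCategory.hom_ext _ _ fun W => funext fun s => ?_
      change posEchelon ((richardson F i j).map f W.1) _ _ = _
      rw [posEchelon_map]
      rfl }
  bijective A := by
    constructor
    · rintro ⟨V, hV⟩ ⟨W, hW⟩ hVW
      have h : (deletion F hi hj).app A V = (deletion F hi hj).app A W :=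
        congrArg Subtype.val (congrArg Prod.fst hVW)
      refine Subtype.ext (eq_of_deletion_eq hi hj h ?_)
      -- Both points have the same image, so their coordinate vectors are compared inside one fibre.
      have hm : (toFibre hi hj V).1 ∈ fibre k k' (baseChange ((deletion F hi hj).app A W)) :=
        h ▸ (toFibre hi hj V).2
      exact congrArg Subtype.val ((fibreCoord_bijective (e := e) (σ := σ) hW).1
        (a₁ := ⟨_, hm⟩) (a₂ := toFibre hi hj W) (congrArg Prod.snd hVW))
    · rintro ⟨⟨V, hV⟩, v⟩
      obtain ⟨u, hu⟩ := (fibreCoord_bijective (e := e) (σ := σ) hV).2 v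
      obtain ⟨W, rfl, hW⟩ := exists_deletion_eq hi hj V u.2
      refine ⟨⟨W, hV⟩, Prod.ext rfl ?_⟩
      rw [← hu]
      exact funext fun s => congrFun hW (e s)

/-- Writing L for the columns of Y at I', one has Y = LX, and restriction to the columns J' gives LM
= 1. The required zeros of L come from j'_b < c < i'_a and the support of Y. -/
theorem exists_mem_chartBase (hi : i k = c) (hj : j k' = c) {K : CommAlgCat.{u} F}
    (hK : IsField K) (V : (richardson F (removeElem i k c hi) (removeElem j k' c hj)).obj K) :
    ∃ (e : Fin (k - k') → Fin d) (σ : Fin d ≃ ChartIndex k k' (k - k')),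
      V ∈ (chartBase F hi hj e σ).obj K := by
  have hX := isEchelon_negEchelon V
  have hY := isEchelon_posEchelon V
  have hYX := eq_mul_of_rowSpan_le (rowSpan_negEchelon_eq V).ge hX.pivot
  have hLM : (posEchelon V).submatrix id (removeElem i k c hi) * baseChange V = 1 := by
    rw [← hY.pivot]
    conv_rhs => rw [hYX]
    rfl
  let _ := hK.toField
  refine exists_isUnit_chartDet (K := K) hLM fun b a hb ha => hY.vanish b _ ?_
  change j (k'.succAbove b) < i (k.succAbove a)
  refine lt_of_lt_of_le (b := c) ?_ (le_of_lt ?_)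
  · rw [← hj]
    exact j.strictMono ((Fin.succAbove_lt_iff_castSucc_lt _ _).2 hb)
  · rw [← hi]
    exact i.strictMono ((Fin.lt_succAbove_iff_le_castSucc _ _).2 ha)

/-- All charts read off entries of the same vector u in the same linear fibre, so the transition
maps are linear. No comparison of I with J is needed, since the cover is tested only at existing
points. -/
theorem isVectorBundle_deletion (hi : i k = c) (hj : j k' = c) :
    IsVectorBundle (deletion F hi hj) (k - k') := by
  refine ⟨ULift ((Fin (k - k') → Fin d) × (Fin d ≃ ChartIndex k k' (k - k'))),
    fun p => chart F hi hj p.down.1 p.down.2, fun K hK V => ?_, ?_⟩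
  · obtain ⟨e, σ, h⟩ := exists_mem_chartBase hi hj hK V
    exact ⟨⟨e, σ⟩, h⟩
  · rintro ⟨e, σ⟩ ⟨e', σ'⟩ A V hV hV'
    obtain ⟨g, hg⟩ := exists_fibreCoord_transition (fibreCoord_bijective (e := e) (σ := σ) hV)
      (fibreCoord_bijective (e := e') (σ := σ') hV')
    refine ⟨g, fun W _ _ hWV => ?_⟩
    subst hWV
    exact hg (toFibre hi hj W)

end Deletion

end Richardson

theorem mainTheorem4 (F : Type u) [Field F] {d n : ℕ} (i j : Fin (d + 1) ↪o Fin n)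
    (k k' : Fin (d + 1)) (h : i k = j k') :
    ((∀ a, i a ≤ j a) → k' ≤ k) ∧
    ∃ ρ : Richardson.richardson F i j ⟶
        Richardson.richardson F (Richardson.removeElem i k (i k) rfl)
          (Richardson.removeElem j k' (i k) h.symm),
      Richardson.IsVectorBundle ρ ((k : ℕ) - (k' : ℕ)) ∧
      ∀ w : Equiv.Perm (Fin (d + 1)), w k' = k →
        (Richardson.stratum F (Richardson.removeElem i k (i k) rfl)
          (Richardson.removeElem j k' (i k) h.symm) (Richardson.restrictPerm w k')).preimage ρ =
        Richardson.stratum F i j w := by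
  refine ⟨fun hij => ?_, Richardson.deletion F rfl h.symm,
    Richardson.isVectorBundle_deletion rfl h.symm,
    fun w hw => Richardson.preimage_stratum rfl h.symm hw⟩
  -- With j_{k'} = i_k, the claim becomes i_k ≤ j_k.
  rw [← j.le_iff_le, ← h]
  exact hij k
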